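/- **Notation.** For $\Omega>0$ let $$PW_\Omega(\mathbb R)=\{f\in L^2(\mathbb R):\ \hat f=0 \text{ a.e. outside } [-\tfrac{\Omega}{2},\tfrac{\Omega}{2}]\},\qquad \hat f(\xi)=\int_{\mathbb R} f(t)e^{-2\pi i t\xi}\,dt,$$ be the space of (complex-valued) bandlimited functions with the $L^2$-norm; $f(x)$ denotes the value of the continuous representative of $f$. For $\lambda>0$ the folding of $x\in\mathbb R$ is $$\mathcal M_\lambda(x)=2\lambda\Big(\Big\{\tfrac{x}{2\lambda}+\tfrac12\Big\}-\tfrac12\Big)\in[-\lambda,\lambda),\qquad \{t\}=t-\lfloor t\rfloor,$$ and $\mathcal M_\lambda(x+iy)=\mathcal M_\lambda(x)+i\mathcal M_\lambda(y)$ for $x,y\in\mathbb R$. Let $|z-w|_\lambda=\inf_{n\in\mathbb Z+i\mathbb Z}|z-w-2\lambda n|$ for $z,w\in\mathbb C$, and let $$\ell^2_\lambda(\mathbb Z)=\{a\in\ell^2(\mathbb Z):\ a_k\in[-\lambda,\lambda)+i[-\lambda,\lambda)\ \text{for all } k\}$$ carry the toral metric $\|a-b\|_{\ell^2_\lambda(\mathbb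 Z)}=\big(\sum_{k\in\mathbb Z}|a_k-b_k|_\lambda^2\big)^{1/2}$. **Theorem (Instability of folded sampling with unbounded inputs).** Let $\Omega,\lambda,\alpha>0$. Then the folded sampling operator $$\mathcal M_{\lambda,\alpha\mathbb Z}:PW_\Omega(\mathbb R)\to\ell^2_\lambda(\mathbb Z),\qquad f\mapsto\big(\mathcal M_\lambda (f(\alpha k))\big)_{k\in\mathbb Z},$$ does not admit a left inverse $\mathcal T:\mathrm{Range}(\mathcal M_{\lambda,\alpha\mathbb Z})\to PW_\Omega(\mathbb R)$ that is continuous at any point of the range, where the range carries the toral metric. More concretely, for every $f\in PW_\Omega(\mathbb R)$ there exists $\varepsilon>0$ such that for every $\delta>0$ there exists $g\in PW_\Omega(\mathbb R)$ with $$\|\mathcal M_{\lambda,\alpha\mathbb Z}f-\mathcal M_{\lambda,\alpha\mathbb Z}g\|_{\ell^2_\lambda(\mathbb Z)}<\delta\qquad\text{but}\qquad\|f-g\|_{L^2(\mathbb R)}>\varepsilon.$$ Both statements remain true if $PW_\Omega(\mathbb R)$ is replaced throughout by its subset of real-valued functions: the restricted operator has no left inverse, from its range to the real-valued functions in $PW_\Omega(\mathbb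 R)$, that is continuous at any point, and for every real-valued $f\in PW_\Omega(\mathbb R)$ there is $\varepsilon>0$ such that for every $\delta>0$ a real-valued $g\in PW_\Omega(\mathbb R)$ as above exists. -/

import Mathlib

open MeasureTheory Set FourierTransform

open scoped ENNReal SchwartzMap ContDiff

noncomputable section

namespace FoldedSampling

/-! ## The Paley-Wiener space -/

/-- The complex Hilbert space `L²(ℝ)`. -/
abbrev L2 : Type := Lp (α := ℝ) ℂ 2

/-- The Paley-Wiener space: square-integrable functions whose Fourier transform
(`f̂(ξ) = ∫ f(t) exp(-2πitξ) dt`, extended to `L²`) vanishes a.e. outside `[-Ω/2, Ω/2]`.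
It carries the `L²` norm. -/
def PW (Ω : ℝ) : Submodule ℂ L2 where
  carrier := {f | ∀ᵐ ξ : ℝ, ξ ∉ Icc (-(Ω / 2)) (Ω / 2) → (𝓕 f : L2) ξ = 0}
  zero_mem' := by
    have h : (𝓕 (0 : L2) : L2) = 0 := (Lp.fourierTransformₗᵢ ℝ ℂ).map_zero
    rw [mem_ofPred_eq, h]
    filter_upwards [Lp.coeFn_zero ℂ 2 (volume : Measure ℝ)] with ξ _ _
    simp
  add_mem' := by
    intro f g hf hg
    have h : (𝓕 (f + g) : L2) = 𝓕 f + 𝓕 g := (Lp.fourierTransformₗᵢ ℝ ℂ).map_add f g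
    rw [mem_ofPred_eq, h]
    filter_upwards [hf, hg, Lp.coeFn_add (𝓕 f : L2) (𝓕 g)] with ξ h1 h2 h3 hξ
    rw [h3, Pi.add_apply, h1 hξ, h2 hξ, add_zero]
  smul_mem' := by
    intro c f hf
    have h : (𝓕 (c • f) : L2) = c • 𝓕 f := (Lp.fourierTransformₗᵢ ℝ ℂ).map_smul c f
    rw [mem_ofPred_eq, h]
    filter_upwards [hf, Lp.coeFn_smul c (𝓕 f : L2)] with ξ h1 h3 hξ
    rw [h3, Pi.smul_apply, h1 hξ, smul_zero]

/-- The real-valued functions in the Paley-Wiener space. -/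
abbrev PWReal (Ω : ℝ) : Type :=
  {f : PW Ω // ∀ᵐ x : ℝ, ((f : L2) x).im = 0}

/-- The value `f(x)` of a bandlimited function, that is, the value at `x` of its continuous
representative `∫ f̂(ξ) exp(2πixξ) dξ` (see `continuous_value` and `coeFn_ae_eq_value`; a continuous
representative is unique). -/
def value {Ω : ℝ} (f : PW Ω) (x : ℝ) : ℂ := 𝓕⁻ (⇑(𝓕 (f : L2) : L2)) x

theorem integrable_fourier {Ω : ℝ} (f : PW Ω) : Integrable (⇑(𝓕 (f : L2) : L2)) := by
  have hI : IntegrableOn (⇑(𝓕 (f : L2) : L2)) (Icc (-(Ω / 2)) (Ω / 2)) :=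
    ((Lp.memLp (𝓕 (f : L2) : L2)).restrict _).integrable (by norm_num)
  refine (hI.integrable_indicator measurableSet_Icc).congr ?_
  filter_upwards [f.2] with ξ hξ
  by_cases h : ξ ∈ Icc (-(Ω / 2)) (Ω / 2)
  · simp [h]
  · simp [h, hξ h]

theorem continuous_value {Ω : ℝ} (f : PW Ω) : Continuous (value f) := by
  have h := (Real.Lp.fourierTransformInv
    (memLp_one_iff_integrable.2 (integrable_fourier f)).toLp).continuous
  rwa [Real.Lp.fourierTransformInv_toLp] at h

theorem coeFn_ae_eq_value {Ω : ℝ} (f : PW Ω) : ⇑(f : L2) =ᵐ[volume] value f := by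
  refine ae_eq_of_integral_contDiff_smul_eq
    ((Lp.memLp (f : L2)).locallyIntegrable (by norm_num))
    (continuous_value f).locallyIntegrable ?_
  intro g hg hgs
  let u : 𝓢(ℝ, ℂ) := HasCompactSupport.toSchwartzMap (f := fun x => (g x : ℂ))
    (hgs.comp_left (g := fun x : ℝ => (x : ℂ)) Complex.ofReal_zero)
    (Complex.ofRealCLM.contDiff.comp hg)
  have hu : ∀ x, u x = (g x : ℂ) := fun _ => rfl
  have h1 : ∫ x, (𝓕⁻ u) x • (𝓕 (f : L2) : L2) x = ∫ x, u x • (f : L2) x := by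
    rw [← Lp.toTemperedDistribution_apply, ← Lp.fourier_toTemperedDistribution_eq,
      TemperedDistribution.fourier_apply, FourierTransform.fourier_fourierInv_eq,
      Lp.toTemperedDistribution_apply]
  have h2 : ∫ x, (𝓕⁻ u) x • (𝓕 (f : L2) : L2) x = ∫ x, u x • value f x := by
    rw [SchwartzMap.fourierInv_coe]
    have hL : Continuous fun p : ℝ × ℝ => (-innerₗ ℝ) p.1 p.2 := continuous_inner.neg
    have := VectorFourier.integral_fourierIntegral_smul_eq_flip (L := -innerₗ ℝ)
      Real.continuous_fourierChar hL (u.integrable (μ := volume)) (integrable_fourier f)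
    have hflip : (-innerₗ ℝ : ℝ →ₗ[ℝ] ℝ →ₗ[ℝ] ℝ).flip = -innerₗ ℝ := by
      ext
      simp
    rw [hflip] at this
    exact this
  have h3 := h1.symm.trans h2
  simpa only [hu, Complex.real_smul, smul_eq_mul] using h3

theorem summable_value {Ω : ℝ} (f : PW Ω) {α : ℝ} (hα : 0 < α) :
    Summable fun k : ℤ => ‖value f (α * k)‖ ^ 2 := by
  set F : ℝ → ℂ := ⇑(𝓕 (f : L2) : L2) with hF
  obtain ⟨N, hN⟩ := exists_nat_gt (α * (|Ω| / 2))
  have hN' : |Ω| / 2 < N / α := by rwa [lt_div_iff₀ hα, mul_comm]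
  let a : ℕ → ℝ := fun j => (j - N) / α
  have hlt : ∀ j, a j < a (j + 1) := fun j => by
    simp only [a]
    push_cast
    gcongr
    linarith
  have hba : ∀ j, a (j + 1) - a j = α⁻¹ := fun j => by
    simp only [a]
    push_cast
    field_simp
    ring
  have hint : ∀ k : ℤ, Integrable fun ξ : ℝ => Complex.exp (↑(2 * Real.pi * (ξ * (α * k))) *
      Complex.I) • F ξ := fun k => by
    refine (integrable_fourier f).bdd_mul (c := 1) (by fun_prop) ?_
    filter_upwards with ξ
    rw [Complex.norm_exp_ofReal_mul_I]
  have hval : ∀ k : ℤ, value f (α * k) =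
      ∑ j ∈ Finset.range (2 * N), α⁻¹ * fourierCoeffOn (hlt j) F (-k) := fun k => by
    have h1 : value f (α * k) = ∫ ξ in a 0..a (2 * N),
        Complex.exp (↑(2 * Real.pi * (ξ * (α * k))) * Complex.I) • F ξ := by
      have hle : a 0 ≤ a (2 * N) := by
        simp only [a]
        push_cast
        gcongr
        linarith [(Nat.cast_nonneg N : (0 : ℝ) ≤ N)]
      rw [intervalIntegral.integral_of_le hle, setIntegral_eq_integral_of_ae_compl_eq_zero]
      · unfold value
        rw [Real.fourierInv_eq']
        refine integral_congr_ae (ae_of_all _ fun ξ => ?_)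
        have hin : inner ℝ ξ (α * (k : ℝ)) = ξ * (α * k) := by
          rw [Real.inner_apply]
        simp only [hin, hF]
      · filter_upwards [f.2] with ξ hξ hξ'
        rw [← hF] at hξ
        rw [hξ, smul_zero]
        contrapose! hξ'
        have := le_abs_self Ω
        simp only [a, mem_Ioc]
        push_cast
        constructor
        · have : ((0 : ℝ) - N) / α = - (N / α) := by ring
          rw [this]
          linarith [hξ'.1]
        · have : ((2 : ℝ) * N - N) / α = N / α := by ring
          rw [this]
          linarith [hξ'.2]
    rw [h1, ← intervalIntegral.sum_integral_adjacent_intervals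
      (fun j _ => (hint k).intervalIntegrable)]
    refine Finset.sum_congr rfl fun j _ => ?_
    rw [fourierCoeffOn_eq_integral, neg_neg, hba]
    simp only [fourier_coe_apply]
    rw [one_div, inv_inv, Complex.real_smul, ← mul_assoc, Complex.ofReal_inv,
      inv_mul_cancel₀ (by exact_mod_cast hα.ne'), one_mul]
    refine intervalIntegral.integral_congr fun ξ _ => ?_
    congr 2
    push_cast
    field_simp
  have hs : ∀ j, Summable fun k : ℤ => ‖fourierCoeffOn (hlt j) F (-k)‖ ^ 2 := fun j =>
    ((Equiv.neg ℤ).summable_iff (f := fun k : ℤ => ‖fourierCoeffOn (hlt j) F k‖ ^ 2)).2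
      (hasSum_sq_fourierCoeffOn (hlt j)
        ((Lp.memLp (𝓕 (f : L2) : L2)).restrict _)).summable
  refine Summable.of_nonneg_of_le (fun _ => sq_nonneg _) (fun k => ?_)
    ((summable_sum fun j (_ : j ∈ Finset.range (2 * N)) =>
      (hs j).mul_left (α⁻¹ ^ 2)).mul_left ((2 * N : ℕ) : ℝ))
  rw [hval]
  refine (pow_le_pow_left₀ (norm_nonneg _) (norm_sum_le _ _) 2).trans ?_
  refine sq_sum_le_card_mul_sum_sq.trans (le_of_eq ?_)
  rw [Finset.card_range]
  congr 1
  refine Finset.sum_congr rfl fun j _ => ?_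
  rw [norm_mul, mul_pow, Complex.norm_real, Real.norm_of_nonneg (by positivity)]

/-! ## Folding -/

/-- The centered folding of a real number into `[-lam, lam)`. -/
def foldReal (lam x : ℝ) : ℝ := 2 * lam * (Int.fract (x / (2 * lam) + 1 / 2) - 1 / 2)

/-- The centered folding of a complex number, acting on real and imaginary parts. -/
def fold (lam : ℝ) (z : ℂ) : ℂ := ⟨foldReal lam z.re, foldReal lam z.im⟩

theorem foldReal_mem {lam : ℝ} (hlam : 0 < lam) (x : ℝ) : foldReal lam x ∈ Ico (-lam) lam := by
  have h0 := Int.fract_nonneg (x / (2 * lam) + 1 / 2)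
  have h1 := Int.fract_lt_one (x / (2 * lam) + 1 / 2)
  constructor <;> unfold foldReal <;> nlinarith

theorem abs_foldReal_le {lam : ℝ} (hlam : 0 < lam) (x : ℝ) : |foldReal lam x| ≤ |x| := by
  obtain ⟨h1, h2⟩ := foldReal_mem hlam x
  rcases lt_or_ge |x| lam with h | h
  · have hx := abs_lt.1 h
    have : Int.fract (x / (2 * lam) + 1 / 2) = x / (2 * lam) + 1 / 2 := by
      rw [Int.fract_eq_self]
      constructor
      · have : -(1 / 2) ≤ x / (2 * lam) := by rw [le_div_iff₀ (by positivity)]; linarith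
        linarith
      · have : x / (2 * lam) < 1 / 2 := by rw [div_lt_iff₀ (by positivity)]; linarith
        linarith
    have : foldReal lam x = x := by
      unfold foldReal
      rw [this]
      field_simp
      ring
    rw [this]
  · exact (abs_le.2 ⟨h1, h2.le⟩).trans h

theorem norm_fold_le {lam : ℝ} (hlam : 0 < lam) (z : ℂ) : ‖fold lam z‖ ≤ ‖z‖ := by
  have h1 := sq_le_sq.2 (abs_foldReal_le hlam z.re)
  have h2 := sq_le_sq.2 (abs_foldReal_le hlam z.im)
  refine le_of_sq_le_sq ?_ (norm_nonneg _)
  rw [Complex.sq_norm, Complex.sq_norm, Complex.normSq_apply, Complex.normSq_apply]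
  simp only [fold]
  nlinarith

/-! ## The toral metric -/

/-- The toral distance `inf {|z - w - 2 lam n| : n ∈ ℤ + iℤ}` of two complex numbers. -/
def toralDist (lam : ℝ) (z w : ℂ) : ℝ := ⨅ n : GaussianInt, ‖z - w - 2 * lam * (n : ℂ)‖

theorem toralDist_bddBelow (lam : ℝ) (z w : ℂ) :
    BddBelow (range fun n : GaussianInt => ‖z - w - 2 * lam * (n : ℂ)‖) :=
  ⟨0, by rintro _ ⟨n, rfl⟩; exact norm_nonneg _⟩

theorem toralDist_nonneg (lam : ℝ) (z w : ℂ) : 0 ≤ toralDist lam z w :=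
  Real.iInf_nonneg fun _ => norm_nonneg _

theorem toralDist_le_norm (lam : ℝ) (z w : ℂ) : toralDist lam z w ≤ ‖z - w‖ :=
  (ciInf_le (toralDist_bddBelow lam z w) 0).trans (by simp)

theorem toralDist_self (lam : ℝ) (z : ℂ) : toralDist lam z z = 0 :=
  le_antisymm ((toralDist_le_norm lam z z).trans (by simp)) (toralDist_nonneg lam z z)

theorem toralDist_comm (lam : ℝ) (z w : ℂ) : toralDist lam z w = toralDist lam w z := by
  have key : ∀ z w : ℂ, toralDist lam z w ≤ toralDist lam w z := by
    intro z w
    refine le_ciInf fun n => (ciInf_le (toralDist_bddBelow lam z w) (-n)).trans (le_of_eq ?_)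
    rw [← norm_neg]
    congr 1
    rw [map_neg]
    ring
  exact le_antisymm (key z w) (key w z)

theorem toralDist_triangle (lam : ℝ) (z w u : ℂ) :
    toralDist lam z u ≤ toralDist lam z w + toralDist lam w u := by
  refine le_ciInf_add_ciInf fun m n =>
    (ciInf_le (toralDist_bddBelow lam z u) (m + n)).trans ?_
  refine le_trans (le_of_eq ?_) (norm_add_le _ _)
  congr 1
  rw [map_add]
  ring

/-- Square-summable sequences with entries in `[-lam, lam) + i [-lam, lam)`. -/
structure FoldedSeq (lam : ℝ) where
  /-- the underlying sequence -/
  seq : ℤ → ℂ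
  summable_sq : Summable fun k => ‖seq k‖ ^ 2
  mem_box : ∀ k, (seq k).re ∈ Ico (-lam) lam ∧ (seq k).im ∈ Ico (-lam) lam

theorem FoldedSeq.summable_toralDist {lam : ℝ} (a b : FoldedSeq lam) :
    Summable fun k => toralDist lam (a.seq k) (b.seq k) ^ 2 := by
  refine Summable.of_nonneg_of_le (fun _ => sq_nonneg _) (fun k => ?_)
    ((a.summable_sq.add b.summable_sq).mul_left 2)
  have h1 := (toralDist_le_norm lam (a.seq k) (b.seq k)).trans (norm_sub_le _ _)
  have h2 := toralDist_nonneg lam (a.seq k) (b.seq k)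
  nlinarith [sq_nonneg (‖a.seq k‖ - ‖b.seq k‖)]

/-- The space of folded sequences with the toral metric `(∑ |a_k - b_k|_lam²)^(1/2)`. -/
instance FoldedSeq.instPseudoMetricSpace (lam : ℝ) : PseudoMetricSpace (FoldedSeq lam) where
  dist a b := √(∑' k, toralDist lam (a.seq k) (b.seq k) ^ 2)
  dist_self a := by simp [toralDist_self]
  dist_comm a b := by simp only [toralDist_comm lam (a.seq _) (b.seq _)]
  dist_triangle a b c := by
    obtain ⟨hsum, hle⟩ := Real.Lp_add_le_tsum_of_nonneg (p := 2) (by norm_num)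
      (fun k => toralDist_nonneg lam (a.seq k) (b.seq k))
      (fun k => toralDist_nonneg lam (b.seq k) (c.seq k))
      (by simpa using a.summable_toralDist b) (by simpa using b.summable_toralDist c)
    rw [Real.sqrt_eq_rpow, Real.sqrt_eq_rpow, Real.sqrt_eq_rpow]
    simp only [Real.rpow_two] at hle hsum
    refine le_trans (Real.rpow_le_rpow (tsum_nonneg fun _ => sq_nonneg _) ?_ (by norm_num)) hle
    exact (a.summable_toralDist c).tsum_le_tsum
      (fun _ => pow_le_pow_left₀ (toralDist_nonneg _ _ _) (toralDist_triangle _ _ _ _) 2) hsum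

/-! ## The folded sampling operator -/

/-- The folded sampling operator `f ↦ (fold f(αk))_k` on the Paley-Wiener space. -/
def foldedSampling (Ω : ℝ) {lam α : ℝ} (hlam : 0 < lam) (hα : 0 < α) (f : PW Ω) :
    FoldedSeq lam where
  seq k := fold lam (value f (α * k))
  summable_sq := Summable.of_nonneg_of_le (fun _ => sq_nonneg _)
    (fun _ => pow_le_pow_left₀ (norm_nonneg _) (norm_fold_le hlam _) 2) (summable_value f hα)
  mem_box _ := ⟨foldReal_mem hlam _, foldReal_mem hlam _⟩

/-- The restriction of the folded sampling operator to real-valued functions. -/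
def foldedSamplingReal (Ω : ℝ) {lam α : ℝ} (hlam : 0 < lam) (hα : 0 < α) (f : PWReal Ω) :
    FoldedSeq lam :=
  foldedSampling Ω hlam hα f.1

end FoldedSampling

end

/-! Folding does not see samples in `2 lam ℤ`, so it suffices to find real bandlimited `h`, with
norm bounded below, whose samples are arbitrarily `ℓ²`-close to `2 lam ℤ`. Adding such an `h` to any
`f` barely moves the folded samples. Inputs are unbounded, so `h` may have huge coefficients.

Take `h = 2 lam ∑ c_j φ(x - α m j)`, `j < D`, with integers `c_j` not all zero and `φ` real,
bandlimited, rapidly decaying, `φ 0 = 1`. About `3mD` samples lie near the shifts. Allowing `|c_j| ≤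
D ^ (4m)` gives enough combinations for the pigeonhole principle to bring all of them, divided by `2
lam`, within `1/D` of integers, at squared cost `O(1/D)` (`exists_int_combination_near_int`).
Farther out, decay of an order depending on `m` but not on `D` beats the polynomial size of the
coefficients (`abs_sum_shift_le`).

If the fixed spacing `m` is large, the shifts hardly interact: the sample of `h` at the peak of the
largest coefficient is at least `lam` (`half_le_abs_sum_shift`). Point evaluation is bounded on `PW
Ω`, hence so is `‖h‖` from below. -/

namespace FoldedSampling

/-! ### Integer combinations of shifts of a decaying sequence -/

/-- A Dirichlet-type pigeonhole principle: a real matrix with few rows has a nonzero integer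
combination of its columns, with small coefficients, that is close to an integer vector. -/
theorem exists_int_combination_near_int {ι κ : Type*} [Fintype ι] [Fintype κ]
    (A : κ → ι → ℝ) (Q R : ℕ) (hR : 0 < R)
    (hcard : R ^ Fintype.card κ < (Q + 1) ^ Fintype.card ι) :
    ∃ c : ι → ℤ, c ≠ 0 ∧ (∀ i, |(c i : ℝ)| ≤ Q) ∧
      ∀ k, ∃ n : ℤ, |∑ i, (c i : ℝ) * A k i - n| ≤ 1 / R := by
  classical
  have hR' : (0 : ℝ) < R := by exact_mod_cast hR
  let s : (ι → Fin (Q + 1)) → κ → ℝ := fun x k => ∑ i, ((x i : ℕ) : ℝ) * A k i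
  have hcell : ∀ y : ℝ, ⌊(R : ℝ) * Int.fract y⌋₊ < R := fun y => by
    rw [Nat.floor_lt (mul_nonneg hR'.le (Int.fract_nonneg y))]
    nlinarith [Int.fract_lt_one y]
  -- The torus is cut into `R ^ |κ|` cubes of side `1 / R`; two coefficient vectors landing in the
  -- same cube have the required difference.
  let cell : (ι → Fin (Q + 1)) → κ → Fin R := fun x k => ⟨_, hcell (s x k)⟩
  obtain ⟨x, y, hxy, heq⟩ := Fintype.exists_ne_map_eq_of_card_lt cell (by simpa using hcard)
  refine ⟨fun i => ((x i : ℕ) : ℤ) - ((y i : ℕ) : ℤ), fun h => hxy ?_, fun i => ?_, fun k => ?_⟩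
  · ext i
    have := congrFun h i
    simp only [Pi.zero_apply] at this
    omega
  · have hx : ((x i : ℕ) : ℝ) ≤ Q := by exact_mod_cast Nat.lt_succ_iff.1 (x i).2
    have hy : ((y i : ℕ) : ℝ) ≤ Q := by exact_mod_cast Nat.lt_succ_iff.1 (y i).2
    have hx0 : (0 : ℝ) ≤ ((x i : ℕ) : ℝ) := Nat.cast_nonneg _
    have hy0 : (0 : ℝ) ≤ ((y i : ℕ) : ℝ) := Nat.cast_nonneg _
    push_cast
    rw [abs_le]
    constructor <;> linarith
  · refine ⟨⌊s x k⌋ - ⌊s y k⌋, ?_⟩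
    have hsum : ∑ i, (((((x i : ℕ) : ℤ) - ((y i : ℕ) : ℤ) : ℤ)) : ℝ) * A k i = s x k - s y k := by
      simp only [s, ← Finset.sum_sub_distrib]
      refine Finset.sum_congr rfl fun i _ => ?_
      push_cast
      ring
    have hk : ⌊(R : ℝ) * Int.fract (s x k)⌋₊ = ⌊(R : ℝ) * Int.fract (s y k)⌋₊ :=
      congrArg Fin.val (congrFun heq k)
    have hx1 := Nat.floor_le (mul_nonneg hR'.le (Int.fract_nonneg (s x k)))
    have hx2 := Nat.lt_floor_add_one ((R : ℝ) * Int.fract (s x k))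
    have hy1 := Nat.floor_le (mul_nonneg hR'.le (Int.fract_nonneg (s y k)))
    have hy2 := Nat.lt_floor_add_one ((R : ℝ) * Int.fract (s y k))
    rw [hk] at hx1 hx2
    have hfr : s x k - s y k - ((⌊s x k⌋ - ⌊s y k⌋ : ℤ) : ℝ) =
        Int.fract (s x k) - Int.fract (s y k) := by
      simp only [Int.fract]
      push_cast
      ring
    rw [hsum, hfr, abs_le, le_div_iff₀ hR', neg_le_iff_add_nonneg, ← neg_le_iff_add_nonneg',
      le_div_iff₀ hR']
    constructor <;> linarith

theorem summable_int_inv_sq : Summable fun k : ℤ => ((k : ℝ) ^ 2)⁻¹ := by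
  simpa using Real.summable_one_div_int_pow.2 (le_refl 2)

/-- Integer combinations of sparse shifts of a sequence with value `1` at `0` are bounded below. -/
theorem half_le_abs_sum_shift {a : ℤ → ℝ} (h0 : a 0 = 1) {C : ℝ}
    (hC : ∀ i, |a i| * |(i : ℝ)| ^ 2 ≤ C) {m : ℕ} (hm : 0 < m)
    (hmC : C * (∑' k : ℤ, ((k : ℝ) ^ 2)⁻¹) / m ^ 2 ≤ 1 / 2) {D : ℕ} {c : Fin D → ℤ} (hc : c ≠ 0) :
    ∃ k : ℤ, 1 / 2 ≤ |∑ j, (c j : ℝ) * a (k - m * (j : ℕ))| := by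
  classical
  obtain ⟨i, hi⟩ := Function.ne_iff.1 hc
  -- At the peak of the shift with largest coefficient, that shift contributes `c j₀` and the others
  -- together at most half of it.
  obtain ⟨j₀, -, hj₀⟩ := Finset.exists_max_image Finset.univ (fun j => |(c j : ℝ)|)
    ⟨i, Finset.mem_univ i⟩
  have hm' : (0 : ℝ) < m := by exact_mod_cast hm
  have hC0 : 0 ≤ C := le_trans (by positivity) (hC 0)
  have hone : 1 ≤ |(c j₀ : ℝ)| := by
    refine le_trans ?_ (hj₀ i (Finset.mem_univ i))
    exact_mod_cast Int.one_le_abs (show c i ≠ 0 from hi)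
  refine ⟨m * (j₀ : ℕ), ?_⟩
  have hterm : ∀ j ∈ Finset.univ.erase j₀,
      |(c j : ℝ) * a (m * (j₀ : ℕ) - m * (j : ℕ))| ≤
        |(c j₀ : ℝ)| * (C / m ^ 2 * ((((j₀ : ℕ) - (j : ℕ) : ℤ) : ℝ) ^ 2)⁻¹) := fun j hj => by
    rw [abs_mul]
    refine mul_le_mul (hj₀ j (Finset.mem_univ j)) ?_ (abs_nonneg _) (abs_nonneg _)
    have hne : (((j₀ : ℕ) - (j : ℕ) : ℤ) : ℝ) ≠ 0 := by
      have : j ≠ j₀ := Finset.ne_of_mem_erase hj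
      have : (j : ℕ) ≠ (j₀ : ℕ) := fun h => this (Fin.ext h)
      rw [Int.cast_ne_zero]
      omega
    have := hC (m * (j₀ : ℕ) - m * (j : ℕ))
    rw [← mul_sub, sq_abs] at this
    rw [← mul_sub]
    push_cast at this hne ⊢
    rw [← div_eq_mul_inv, div_div, le_div_iff₀ (by positivity)]
    linarith [mul_pow (m : ℝ) ((j₀ : ℕ) - (j : ℕ) : ℝ) 2]
  have hrest : |∑ j ∈ Finset.univ.erase j₀, (c j : ℝ) * a (m * (j₀ : ℕ) - m * (j : ℕ))| ≤
      |(c j₀ : ℝ)| * (1 / 2) := by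
    refine (Finset.abs_sum_le_sum_abs _ _).trans ((Finset.sum_le_sum hterm).trans ?_)
    rw [← Finset.mul_sum, ← Finset.mul_sum]
    refine mul_le_mul_of_nonneg_left (le_trans ?_ hmC) (abs_nonneg _)
    rw [mul_div_right_comm]
    refine mul_le_mul_of_nonneg_left ?_ (by positivity)
    have hinj : Function.Injective fun j : Fin D => ((j₀ : ℕ) - (j : ℕ) : ℤ) := fun j j' h => by
      apply Fin.ext
      simp only at h
      omega
    rw [← Finset.sum_image (f := fun k : ℤ => ((k : ℝ) ^ 2)⁻¹) (hinj.injOn)]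
    exact summable_int_inv_sq.sum_le_tsum _ fun _ _ => by positivity
  rw [← Finset.add_sum_erase _ _ (Finset.mem_univ j₀), sub_self, h0, mul_one]
  have := abs_sub_abs_le_abs_sub (c j₀ : ℝ)
    (-∑ j ∈ Finset.univ.erase j₀, (c j : ℝ) * a (m * (j₀ : ℕ) - m * (j : ℕ)))
  rw [abs_neg, sub_neg_eq_add] at this
  linarith

/-- Far from the shifts, a combination of shifts of a rapidly decaying sequence is small. -/
theorem abs_sum_shift_le {a : ℤ → ℝ} {K : ℕ} {C : ℝ}
    (hC : ∀ i, |a i| * |(i : ℝ)| ^ (K + 3) ≤ C) {m D : ℕ} (hm : 0 < m) (hD : 0 < D)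
    {c : Fin D → ℤ} (hc : ∀ j, |(c j : ℝ)| ≤ (D : ℝ) ^ K)
    {k : ℤ} (hk : k < -(m * D) ∨ 2 * (m * D) < k) :
    |∑ j, (c j : ℝ) * a (k - m * (j : ℕ))| ≤ 2 ^ (K + 3) * C / D * |(k : ℝ)|⁻¹ := by
  have hmD : (D : ℤ) ≤ m * D := by nlinarith
  have hkD : (D : ℤ) ≤ |k| := by
    rcases hk with h | h
    · rw [abs_of_neg (by omega)]; omega
    · rw [abs_of_pos (by omega)]; omega
  have hkD' : (D : ℝ) ≤ |(k : ℝ)| := by exact_mod_cast hkD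
  have hD' : (0 : ℝ) < D := by exact_mod_cast hD
  have hkpos : 0 < |(k : ℝ)| := hD'.trans_le hkD'
  have hC0 : 0 ≤ C := le_trans (by positivity) (hC 0)
  have hterm : ∀ j ∈ Finset.univ, |(c j : ℝ) * a (k - m * (j : ℕ))| ≤
      (D : ℝ) ^ K * (C * (2 / |(k : ℝ)|) ^ (K + 3)) := fun j _ => by
    rw [abs_mul]
    refine mul_le_mul (hc j) ?_ (abs_nonneg _) (by positivity)
    have hj : (m : ℤ) * (j : ℕ) ≤ m * D := by
      have : ((j : ℕ) : ℤ) ≤ D := by exact_mod_cast j.2.le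
      exact mul_le_mul_of_nonneg_left this (by positivity)
    have hj0 : (0 : ℤ) ≤ (m : ℤ) * (j : ℕ) := by positivity
    -- The shifts lie in `[0, mD]`, so the excluded margins keep `k` at distance at least `|k| / 2`
    -- from each.
    have hfar : |k| ≤ 2 * |k - m * (j : ℕ)| := by
      rcases hk with h | h
      · rw [abs_of_neg (by omega), abs_of_neg (by omega)]; omega
      · rw [abs_of_pos (by omega), abs_of_pos (by omega)]; omega
    have hfar' : |(k : ℝ)| / 2 ≤ |((k - m * (j : ℕ) : ℤ) : ℝ)| := by
      have : |(k : ℝ)| ≤ 2 * |((k - m * (j : ℕ) : ℤ) : ℝ)| := by exact_mod_cast hfar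
      linarith
    have h1 : |a (k - m * (j : ℕ))| * (|(k : ℝ)| / 2) ^ (K + 3) ≤ C :=
      (mul_le_mul_of_nonneg_left (pow_le_pow_left₀ (by positivity) hfar' _)
        (abs_nonneg _)).trans (hC _)
    rw [← inv_div, inv_pow, ← div_eq_mul_inv, le_div_iff₀ (by positivity)]
    exact h1
  refine (Finset.abs_sum_le_sum_abs _ _).trans ((Finset.sum_le_sum hterm).trans ?_)
  rw [Finset.sum_const, Finset.card_univ, Fintype.card_fin, nsmul_eq_mul]
  have h2 : (D : ℝ) ^ (K + 2) ≤ |(k : ℝ)| ^ (K + 2) := pow_le_pow_left₀ hD'.le hkD' _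
  -- The number of terms and the coefficient bound cost `D ^ (K + 1)`. Of the decay `|k| ^ (-(K +
  -- 3))`, `K + 2` powers absorb this and leave `1 / D`; the last one gives square-summability in
  -- `k`.
  have h3 : (D : ℝ) * ((D : ℝ) ^ K * (C * (2 / |(k : ℝ)|) ^ (K + 3))) =
      2 ^ (K + 3) * C / D * |(k : ℝ)|⁻¹ * ((D : ℝ) ^ (K + 2) / |(k : ℝ)| ^ (K + 2)) := by
    rw [div_pow]
    field_simp
    ring
  rw [h3]
  exact mul_le_of_le_one_right (by positivity) ((div_le_one (by positivity)).2 h2)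

/-- For a rapidly decaying real sequence with value `1` at `0`, there are integer combinations of
its shifts which are arbitrarily close to integer sequences in `ℓ²` and do not tend to zero. -/
theorem exists_shift_combination_near_int {a : ℤ → ℝ} (h0 : a 0 = 1)
    (ha : ∀ K : ℕ, ∃ C, ∀ i, |a i| * |(i : ℝ)| ^ K ≤ C) :
    ∃ m : ℕ, ∀ δ : ℝ, 0 < δ → ∃ D : ℕ, ∃ c : Fin D → ℤ, ∃ n : ℤ → ℤ,
      Summable (fun k => (∑ j, (c j : ℝ) * a (k - m * (j : ℕ)) - n k) ^ 2) ∧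
      ∑' k, (∑ j, (c j : ℝ) * a (k - m * (j : ℕ)) - n k) ^ 2 < δ ∧
      ∃ k : ℤ, 1 / 2 ≤ |∑ j, (c j : ℝ) * a (k - m * (j : ℕ))| := by
  classical
  obtain ⟨C₂, hC₂⟩ := ha 2
  set S : ℝ := ∑' k : ℤ, ((k : ℝ) ^ 2)⁻¹ with hS
  obtain ⟨m, hm1, hm⟩ : ∃ m : ℕ, 0 < m ∧ C₂ * S / m ^ 2 ≤ 1 / 2 := by
    obtain ⟨m, hm⟩ := exists_nat_gt (2 * |C₂ * S|)
    have h1 := le_abs_self (C₂ * S)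
    have h2 := abs_nonneg (C₂ * S)
    have hmpos : (0 : ℝ) < m := by linarith
    have hm1 : 0 < m := by exact_mod_cast hmpos
    have hm1' : (1 : ℝ) ≤ m := by exact_mod_cast hm1
    refine ⟨m, hm1, ?_⟩
    rw [div_le_iff₀ (by positivity)]
    nlinarith
  refine ⟨m, fun δ hδ => ?_⟩
  -- Decay order `K + 3` with `K = 4 * m`, the exponent of the coefficient bound `D ^ (4 * m)`
  -- below; `C` is thus fixed before `D`.
  obtain ⟨C, hC⟩ := ha (4 * m + 3)
  set B : ℝ := 2 ^ (4 * m + 3) * C with hB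
  have hS0 : 0 ≤ S := tsum_nonneg fun _ => by positivity
  obtain ⟨D, hD⟩ := exists_nat_gt ((4 * m + B ^ 2 * S) / δ)
  have hD' : (0 : ℝ) < D := lt_of_le_of_lt (by positivity) hD
  have hDpos : 0 < D := by exact_mod_cast hD'
  have hD1 : (1 : ℝ) ≤ D := by exact_mod_cast hDpos
  set W : Finset ℤ := Finset.Icc (-(m * D : ℤ)) (2 * (m * D)) with hW
  have hWcard : W.card ≤ 4 * m * D := by
    have : (1 : ℤ) ≤ m * D := by exact_mod_cast Nat.mul_pos hm1 hDpos
    rw [hW, Int.card_Icc, Int.toNat_le]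
    push_cast
    linarith
  obtain ⟨c, hc, hcQ, hcn⟩ := exists_int_combination_near_int
    (fun (k : W) (j : Fin D) => a (k - m * (j : ℕ))) (D ^ (4 * m)) D hDpos (by
      rw [Fintype.card_coe, Fintype.card_fin]
      calc D ^ W.card ≤ D ^ (4 * m * D) := Nat.pow_le_pow_right hDpos hWcard
        _ = (D ^ (4 * m)) ^ D := pow_mul _ _ _
        _ < _ := Nat.pow_lt_pow_left (Nat.lt_succ_self _) hDpos.ne')
  push_cast at hcQ
  choose n hn using hcn
  -- Integers from the pigeonhole step inside the window, zero in the tail.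
  let n' : ℤ → ℤ := fun k => if h : k ∈ W then n ⟨k, h⟩ else 0
  let b : ℤ → ℝ := fun k =>
    (if k ∈ W then (1 / (D : ℝ)) ^ 2 else 0) + (B / D) ^ 2 * ((k : ℝ) ^ 2)⁻¹
  have hb : ∀ k, (∑ j, (c j : ℝ) * a (k - m * (j : ℕ)) - n' k) ^ 2 ≤ b k := fun k => by
    by_cases hk : k ∈ W
    · simp only [n', b, hk, dif_pos, if_true]
      have := sq_le_sq' (by linarith [abs_le.1 (hn ⟨k, hk⟩)]) (abs_le.1 (hn ⟨k, hk⟩)).2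
      refine this.trans (le_add_of_nonneg_right (by positivity))
    · simp only [n', b, hk, dif_neg, not_false_iff, if_false, Int.cast_zero, sub_zero, zero_add]
      have hk' : k < -(m * D) ∨ 2 * (m * D) < k := by
        rw [hW, Finset.mem_Icc] at hk
        omega
      have := abs_sum_shift_le hC hm1 hDpos hcQ hk'
      rw [← sq_abs, ← sq_abs (k : ℝ), ← inv_pow, ← mul_pow]
      exact pow_le_pow_left₀ (abs_nonneg _) this 2
  have hbW : HasSum (fun k => if k ∈ W then (1 / (D : ℝ)) ^ 2 else 0)
      (W.card * (1 / (D : ℝ)) ^ 2) := by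
    have := hasSum_sum_of_ne_finset_zero (L := .unconditional ℤ) (f := fun k => if k ∈ W then (1 / (D : ℝ)) ^ 2 else 0)
      (s := W) (fun k hk => if_neg hk)
    convert this using 1
    rw [Finset.sum_ite_mem, Finset.inter_self, Finset.sum_const, nsmul_eq_mul]
  have hbsum : HasSum b (W.card * (1 / (D : ℝ)) ^ 2 + (B / D) ^ 2 * S) :=
    hbW.add (summable_int_inv_sq.hasSum.mul_left _)
  have hsum := Summable.of_nonneg_of_le (fun _ => sq_nonneg _) hb hbsum.summable
  refine ⟨D, c, n', hsum, ?_, half_le_abs_sum_shift h0 hC₂ hm1 hm hc⟩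
  refine (hsum.tsum_le_tsum hb hbsum.summable).trans_lt ?_
  rw [hbsum.tsum_eq]
  have h1 : (W.card : ℝ) * (1 / (D : ℝ)) ^ 2 ≤ 4 * m / D := by
    have : (W.card : ℝ) ≤ 4 * m * D := by exact_mod_cast hWcard
    refine (mul_le_mul_of_nonneg_right this (by positivity)).trans (le_of_eq ?_)
    field_simp
  have h2 : (B / D) ^ 2 * S ≤ B ^ 2 * S / D := by
    rw [div_pow, div_mul_eq_mul_div]
    gcongr
    nlinarith
  have h3 : (4 * m + B ^ 2 * S) / D < δ := by
    rw [div_lt_iff₀ hδ] at hD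
    rw [div_lt_iff₀ hD']
    linarith
  rw [add_div] at h3
  linarith

/-! ### Point evaluation and a bandlimited kernel -/

theorem value_eq_integral {Ω : ℝ} {f : PW Ω} {F : ℝ → ℂ} (h : ⇑(𝓕 (f : L2) : L2) =ᵐ[volume] F)
    (x : ℝ) : value f x = 𝓕⁻ F x := by
  unfold value
  rw [Real.fourierInv_eq', Real.fourierInv_eq']
  refine integral_congr_ae ?_
  filter_upwards [h] with ξ hξ
  rw [hξ]

theorem integrable_fourierChar_smul_fourier {Ω : ℝ} (f : PW Ω) (x : ℝ) :
    Integrable fun ξ : ℝ => Real.fourierChar (inner ℝ ξ x) • (𝓕 (f : L2) : L2) ξ := by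
  have := (VectorFourier.fourierIntegral_convergent_iff Real.continuous_fourierChar
    (L := innerₗ ℝ) continuous_inner (-x)).2 (integrable_fourier f)
  simpa using this

/-- Evaluation of bandlimited functions at a point, as a linear map. -/
noncomputable def valueₗ (Ω x : ℝ) : PW Ω →ₗ[ℂ] ℂ where
  toFun f := value f x
  map_add' f g := by
    have h : (𝓕 ((f + g : PW Ω) : L2) : L2) = 𝓕 (f : L2) + 𝓕 (g : L2) :=
      (Lp.fourierTransformₗᵢ ℝ ℂ).map_add f g
    have h' := Lp.coeFn_add (𝓕 (f : L2) : L2) (𝓕 (g : L2))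
    rw [← h] at h'
    rw [value_eq_integral h', Real.fourierInv_eq, value, value, Real.fourierInv_eq,
      Real.fourierInv_eq, ← integral_add]
    · simp only [Pi.add_apply, smul_add]
    · exact integrable_fourierChar_smul_fourier f x
    · exact integrable_fourierChar_smul_fourier g x
  map_smul' c f := by
    have h : (𝓕 ((c • f : PW Ω) : L2) : L2) = c • 𝓕 (f : L2) :=
      (Lp.fourierTransformₗᵢ ℝ ℂ).map_smul c f
    have h' := Lp.coeFn_smul c (𝓕 (f : L2) : L2)
    rw [← h] at h'
    rw [value_eq_integral h', Real.fourierInv_eq, value, Real.fourierInv_eq, RingHom.id_apply,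
      ← integral_smul]
    simp only [Pi.smul_apply, smul_comm c]

@[simp]
theorem valueₗ_apply {Ω x : ℝ} (f : PW Ω) : valueₗ Ω x f = value f x := rfl

/-- Cauchy–Schwarz on the spectral interval of length `Ω`, then Plancherel. This turns one large
sample into a lower bound for the norm. -/
theorem norm_value_le {Ω : ℝ} (f : PW Ω) (x : ℝ) : ‖value f x‖ ≤ √Ω * ‖f‖ := by
  set F : L2 := 𝓕 (f : L2) with hF
  have hsupp : ⇑F =ᵐ[volume] (Icc (-(Ω / 2)) (Ω / 2)).indicator F := by
    filter_upwards [f.2] with ξ hξ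
    by_cases h : ξ ∈ Icc (-(Ω / 2)) (Ω / 2)
    · simp [h]
    · simp [h, F, hξ h]
  have h1 : ‖value f x‖ ≤ ∫ ξ, ‖F ξ‖ := by
    unfold value
    rw [Real.fourierInv_eq]
    refine (norm_integral_le_integral_norm _).trans (le_of_eq ?_)
    simp only [Circle.norm_smul, hF]
  have h2 : eLpNorm F 1 volume ≤ eLpNorm F 2 volume * ENNReal.ofReal √Ω := by
    rw [eLpNorm_congr_ae hsupp, eLpNorm_indicator_eq_eLpNorm_restrict measurableSet_Icc]
    refine (eLpNorm_le_eLpNorm_mul_rpow_measure_univ (p := 1) (q := 2) (by norm_num)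
      (Lp.aestronglyMeasurable F).restrict).trans ?_
    gcongr
    · exact Measure.restrict_le_self
    · rw [Measure.restrict_apply_univ, Real.volume_Icc]
      have hlen : Ω / 2 - -(Ω / 2) = Ω := by ring
      have hexp : 1 / ENNReal.toReal 1 - 1 / ENNReal.toReal 2 = 1 / 2 := by norm_num
      rw [hlen, hexp]
      rcases le_total 0 Ω with hΩ | hΩ
      · rw [ENNReal.ofReal_rpow_of_nonneg hΩ (by norm_num), Real.sqrt_eq_rpow]
      · rw [ENNReal.ofReal_of_nonpos hΩ, ENNReal.zero_rpow_of_pos (by norm_num)]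
        exact zero_le
  have h3 : ∫ ξ, ‖F ξ‖ = (eLpNorm F 1 volume).toReal := by
    rw [eLpNorm_one_eq_lintegral_enorm, integral_norm_eq_lintegral_enorm
      (Lp.aestronglyMeasurable F)]
  have h4 : ‖f‖ = (eLpNorm F 2 volume).toReal := by
    rw [← Lp.norm_def, hF, Lp.norm_fourier_eq]
    rfl
  rw [h4, mul_comm]
  refine h1.trans (h3.le.trans ?_)
  refine (ENNReal.toReal_mono (ENNReal.mul_ne_top (Lp.eLpNorm_ne_top F) ENNReal.ofReal_ne_top)
    h2).trans (le_of_eq ?_)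
  rw [ENNReal.toReal_mul, ENNReal.toReal_ofReal (Real.sqrt_nonneg _)]

/-- A Schwartz function supported in `[-Ω/2, Ω/2]` is the Fourier transform of a bandlimited
function. -/
theorem exists_value_eq_fourierInv {Ω : ℝ} (U : 𝓢(ℝ, ℂ))
    (hU : ∀ ξ, ξ ∉ Icc (-(Ω / 2)) (Ω / 2) → U ξ = 0) :
    ∃ f : PW Ω, ∀ x, value f x = 𝓕⁻ (U : ℝ → ℂ) x := by
  have hfour : (𝓕 ((𝓕⁻ U).toLp 2 : L2) : L2) = U.toLp 2 := by
    rw [SchwartzMap.toLp_fourier_eq, FourierTransform.fourier_fourierInv_eq]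
  have hae : ⇑(𝓕 ((𝓕⁻ U).toLp 2 : L2) : L2) =ᵐ[volume] U := by
    rw [hfour]
    exact U.coeFn_toLp 2
  refine ⟨⟨(𝓕⁻ U).toLp 2, ?_⟩, fun x => value_eq_integral hae x⟩
  filter_upwards [hae] with ξ hξ hξ'
  rw [hξ, hU ξ hξ']

/-- There is a real, rapidly decaying function with value `1` at `0` all of whose translates are
bandlimited. -/
theorem exists_rapidly_decaying_kernel {Ω : ℝ} (hΩ : 0 < Ω) :
    ∃ φ : ℝ → ℝ, φ 0 = 1 ∧ (∀ K : ℕ, ∃ C, ∀ x, |φ x| * |x| ^ K ≤ C) ∧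
      ∀ s, ∃ f : PW Ω, ∀ x, value f x = φ (x - s) := by
  let b : ContDiffBump (0 : ℝ) := ⟨Ω / 4, Ω / 2, by positivity, by linarith⟩
  let u : ℝ → ℂ := fun ξ => (b.normed volume ξ : ℂ)
  have hsmooth : ContDiff ℝ ∞ u := Complex.ofRealCLM.contDiff.comp b.contDiff_normed
  have hcomp : HasCompactSupport u :=
    b.hasCompactSupport_normed.comp_left (g := fun x : ℝ => (x : ℂ)) Complex.ofReal_zero
  have hzero : ∀ ξ, ξ ∉ Icc (-(Ω / 2)) (Ω / 2) → u ξ = 0 := fun ξ hξ => by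
    have : ξ ∉ Function.support (b.normed volume) := by
      rw [b.support_normed_eq, Real.ball_eq_Ioo, zero_sub, zero_add]
      exact fun h => hξ (Ioo_subset_Icc_self h)
    simp only [u, Function.notMem_support.1 this, Complex.ofReal_zero]
  -- The bump is real and even, so its inverse transform is real.
  have hreal : ∀ x, (starRingEnd ℂ) (𝓕⁻ u x) = 𝓕⁻ u x := fun x => by
    rw [Real.fourierInv_eq', ← integral_conj, ← integral_neg_eq_self]
    refine integral_congr_ae (ae_of_all _ fun ξ => ?_)
    simp only [u, smul_eq_mul, map_mul, Complex.conj_ofReal, b.normed_neg, ← Complex.exp_conj,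
      Complex.conj_I, Real.inner_apply]
    congr 2
    push_cast
    ring
  let us : 𝓢(ℝ, ℂ) := hcomp.toSchwartzMap hsmooth
  have hus : ⇑us = u := rfl
  refine ⟨fun x => (𝓕⁻ u x).re, ?_, fun K => ?_, fun s => ?_⟩
  · have : 𝓕⁻ u 0 = ((∫ ξ, b.normed volume ξ : ℝ) : ℂ) := by
      rw [Real.fourierInv_eq', ← integral_complex_ofReal]
      simp [u]
    simp only [this, b.integral_normed, Complex.ofReal_re]
  · obtain ⟨C, hC⟩ := (𝓕⁻ us).decay K 0
    refine ⟨C, fun x => ?_⟩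
    have h := hC.2 x
    rw [norm_iteratedFDeriv_zero, SchwartzMap.fourierInv_coe, hus, Real.norm_eq_abs,
      mul_comm] at h
    exact (mul_le_mul_of_nonneg_right (Complex.abs_re_le_norm _) (by positivity)).trans h
  -- Translation by `s` is modulation of the spectrum, which preserves its support.
  · let e : ℝ → ℂ := fun ξ => Complex.exp (↑(2 * Real.pi * (ξ * -s)) * Complex.I)
    have he : ContDiff ℝ ∞ e :=
      ((Complex.ofRealCLM.contDiff.comp
        (contDiff_const.mul (contDiff_id.mul contDiff_const))).mul contDiff_const).cexp
    obtain ⟨f, hf⟩ := exists_value_eq_fourierInv (Ω := Ω)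
      ((hcomp.mul_left (f := e)).toSchwartzMap (he.mul hsmooth)) (fun ξ hξ => by
        change e ξ * u ξ = 0
        rw [hzero ξ hξ, mul_zero])
    refine ⟨f, fun x => ?_⟩
    rw [hf, Complex.conj_eq_iff_re.1 (hreal _), Real.fourierInv_eq', Real.fourierInv_eq']
    refine integral_congr_ae (ae_of_all _ fun ξ => ?_)
    change _ • (e ξ * u ξ) = _
    simp only [e, smul_eq_mul, Real.inner_apply, ← mul_assoc, ← Complex.exp_add]
    congr 2
    push_cast
    ring

/-! ### Perturbations nearly invisible to folding -/

theorem exists_foldReal_eq {lam : ℝ} (hlam : 0 < lam) (x : ℝ) :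
    ∃ n : ℤ, foldReal lam x = x - 2 * lam * n := by
  refine ⟨⌊x / (2 * lam) + 1 / 2⌋, ?_⟩
  unfold foldReal
  rw [Int.fract]
  field_simp
  ring

theorem exists_fold_eq {lam : ℝ} (hlam : 0 < lam) (z : ℂ) :
    ∃ n : GaussianInt, fold lam z = z - 2 * lam * (n : ℂ) := by
  obtain ⟨p, hp⟩ := exists_foldReal_eq hlam z.re
  obtain ⟨q, hq⟩ := exists_foldReal_eq hlam z.im
  refine ⟨⟨p, q⟩, Complex.ext ?_ ?_⟩ <;> simp [fold, hp, hq, GaussianInt.toComplex_def]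

/-- Folding moves each point by an element of the lattice `2 lam (ℤ + iℤ)`, which the infimum
absorbs. -/
theorem toralDist_fold_le {lam : ℝ} (hlam : 0 < lam) (z w : ℂ) (n : GaussianInt) :
    toralDist lam (fold lam z) (fold lam w) ≤ ‖z - w - 2 * lam * (n : ℂ)‖ := by
  obtain ⟨p, hp⟩ := exists_fold_eq hlam z
  obtain ⟨q, hq⟩ := exists_fold_eq hlam w
  refine (ciInf_le (toralDist_bddBelow lam _ _) (n - p + q)).trans (le_of_eq ?_)
  rw [hp, hq, map_add, map_sub]
  congr 1
  ring

/-- Bandlimited functions whose samples are close to `2 lam ℤ` have little effect on the folded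
samples. -/
theorem dist_foldedSampling_add_lt {Ω lam α : ℝ} (hlam : 0 < lam) (hα : 0 < α) (f h : PW Ω)
    {x : ℤ → ℝ} {n : ℤ → ℤ} (hx : ∀ k : ℤ, value h (α * k) = ((2 * lam * x k : ℝ) : ℂ))
    (hs : Summable fun k => (x k - n k) ^ 2) {δ : ℝ} (hδ : 0 < δ)
    (hlt : ∑' k, (x k - n k) ^ 2 < δ ^ 2 / (4 * lam ^ 2)) :
    dist (foldedSampling Ω hlam hα f) (foldedSampling Ω hlam hα (f + h)) < δ := by
  have hle : ∀ k : ℤ, toralDist lam ((foldedSampling Ω hlam hα f).seq k)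
      ((foldedSampling Ω hlam hα (f + h)).seq k) ^ 2 ≤ 4 * lam ^ 2 * (x k - n k) ^ 2 := fun k => by
    refine (pow_le_pow_left₀ (toralDist_nonneg _ _ _)
      (toralDist_fold_le hlam _ _ (-(n k : GaussianInt))) 2).trans (le_of_eq ?_)
    have hadd : value (f + h) (α * k) = value f (α * k) + value h (α * k) :=
      (valueₗ Ω (α * k)).map_add f h
    have : value f (α * k) - value (f + h) (α * k) - 2 * lam * ((-(n k : GaussianInt) :
        GaussianInt) : ℂ) = ((-(2 * lam * (x k - n k)) : ℝ) : ℂ) := by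
      rw [hadd, hx, map_neg, map_intCast]
      push_cast
      ring
    rw [this, Complex.norm_real, Real.norm_eq_abs, sq_abs]
    ring
  change √(∑' k, _) < δ
  rw [Real.sqrt_lt' hδ]
  refine ((FoldedSeq.summable_toralDist _ _).tsum_le_tsum hle (hs.mul_left _)).trans_lt ?_
  rw [tsum_mul_left]
  rw [lt_div_iff₀ (by positivity)] at hlt
  linarith

/-- There are real-valued bandlimited functions, bounded away from zero in norm, which perturb the
folded samples of any function arbitrarily little. -/
theorem exists_perturbation {Ω lam α : ℝ} (hΩ : 0 < Ω) (hlam : 0 < lam) (hα : 0 < α) :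
    ∃ ε : ℝ, 0 < ε ∧ ∀ δ : ℝ, 0 < δ → ∃ h : PW Ω, (∀ x, (value h x).im = 0) ∧ ε < ‖h‖ ∧
      ∀ f : PW Ω, dist (foldedSampling Ω hlam hα f) (foldedSampling Ω hlam hα (f + h)) < δ := by
  obtain ⟨φ, h0, hφ, htrans⟩ := exists_rapidly_decaying_kernel hΩ
  choose e he using htrans
  obtain ⟨m, hm⟩ := exists_shift_combination_near_int (a := fun i : ℤ => φ (α * i))
    (by simpa using h0) (fun K => by
      obtain ⟨C, hC⟩ := hφ K
      refine ⟨C / α ^ K, fun i => ?_⟩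
      rw [le_div_iff₀ (by positivity)]
      have := hC (α * i)
      rw [abs_mul, abs_of_pos hα, mul_pow] at this
      linarith)
  have hΩ' : 0 < √Ω := Real.sqrt_pos.2 hΩ
  -- Some sample of `h` has modulus at least `2 lam * (1 / 2) = lam`, so `‖h‖ ≥ lam / √Ω`; halving
  -- makes the inequality strict.
  refine ⟨lam / (2 * √Ω), by positivity, fun δ hδ => ?_⟩
  obtain ⟨D, c, n, hs, hlt, k, hk⟩ := hm (δ ^ 2 / (4 * lam ^ 2)) (by positivity)
  let h : PW Ω := ∑ j : Fin D, ((2 * lam * c j : ℝ) : ℂ) • e (α * (m * (j : ℕ)))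
  have hval : ∀ x, value h x =
      ((∑ j : Fin D, 2 * lam * c j * φ (x - α * (m * (j : ℕ))) : ℝ) : ℂ) := fun x => by
    rw [← valueₗ_apply, map_sum, Complex.ofReal_sum]
    refine Finset.sum_congr rfl fun j _ => ?_
    rw [map_smul, valueₗ_apply, he, smul_eq_mul, ← Complex.ofReal_mul]
  have hsamp : ∀ k : ℤ, value h (α * k) = ((2 * lam *
      ∑ j : Fin D, c j * φ (α * ((k - m * (j : ℕ) : ℤ) : ℝ)) : ℝ) : ℂ) := fun k => by
    rw [hval, Finset.mul_sum]
    congr 1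
    refine Finset.sum_congr rfl fun j _ => ?_
    push_cast
    rw [mul_sub, mul_assoc]
  refine ⟨h, fun x => by rw [hval, Complex.ofReal_im], ?_,
    fun f => dist_foldedSampling_add_lt hlam hα f h hsamp hs hδ hlt⟩
  have h1 := norm_value_le h (α * k)
  rw [hsamp, Complex.norm_real, Real.norm_eq_abs, abs_mul, abs_of_pos (by positivity)] at h1
  rw [div_lt_iff₀ (by positivity)]
  nlinarith

/-! ### From perturbations to discontinuity -/

/-- A left inverse of a map that is arbitrarily non-injective near every point, at a uniform scale
depending on the point, is discontinuous everywhere. -/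
theorem not_continuousAt_of_leftInverse {X Y : Type*} [PseudoMetricSpace X] [PseudoMetricSpace Y]
    {F : X → Y} (hF : ∀ f, ∃ ε : ℝ, 0 < ε ∧ ∀ δ : ℝ, 0 < δ → ∃ g, dist (F f) (F g) < δ ∧
      ε < dist f g)
    {T : range F → X} (hT : Function.LeftInverse T (rangeFactorization F)) (a : range F) :
    ¬ ContinuousAt T a := by
  obtain ⟨_, f, rfl⟩ := a
  intro hcont
  obtain ⟨ε, hε, h⟩ := hF f
  obtain ⟨δ, hδ, hball⟩ := Metric.continuousAt_iff.1 hcont ε hε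
  obtain ⟨g, hg, hfar⟩ := h δ hδ
  have := hball (x := rangeFactorization F g) (by rw [dist_comm]; exact hg)
  have hf : T ⟨F f, ⟨f, rfl⟩⟩ = f := hT f
  rw [hT g, hf, dist_comm] at this
  exact lt_asymm hfar this

theorem exists_unstable {Ω lam α : ℝ} (hΩ : 0 < Ω) (hlam : 0 < lam) (hα : 0 < α) (f : PW Ω) :
    ∃ ε : ℝ, 0 < ε ∧ ∀ δ : ℝ, 0 < δ → ∃ g : PW Ω,
      dist (foldedSampling Ω hlam hα f) (foldedSampling Ω hlam hα g) < δ ∧ ε < ‖f - g‖ := by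
  obtain ⟨ε, hε, hpert⟩ := exists_perturbation hΩ hlam hα
  refine ⟨ε, hε, fun δ hδ => ?_⟩
  obtain ⟨h, -, hnorm, hdist⟩ := hpert δ hδ
  exact ⟨f + h, hdist f, by rwa [sub_add_cancel_left, norm_neg]⟩

theorem exists_unstable_real {Ω lam α : ℝ} (hΩ : 0 < Ω) (hlam : 0 < lam) (hα : 0 < α)
    (f : PWReal Ω) :
    ∃ ε : ℝ, 0 < ε ∧ ∀ δ : ℝ, 0 < δ → ∃ g : PWReal Ω,
      dist (foldedSamplingReal Ω hlam hα f) (foldedSamplingReal Ω hlam hα g) < δ ∧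
        ε < ‖f.1 - g.1‖ := by
  obtain ⟨ε, hε, hpert⟩ := exists_perturbation hΩ hlam hα
  refine ⟨ε, hε, fun δ hδ => ?_⟩
  obtain ⟨h, hreal, hnorm, hdist⟩ := hpert δ hδ
  refine ⟨⟨f.1 + h, ?_⟩, hdist f.1, by rwa [sub_add_cancel_left, norm_neg]⟩
  filter_upwards [f.2, coeFn_ae_eq_value h, Lp.coeFn_add (f.1 : L2) (h : L2)] with x h1 h2 h3
  rw [Submodule.coe_add, h3, Pi.add_apply, Complex.add_im, h1, h2, hreal, add_zero]

end FoldedSampling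

theorem theorem2p1 (Ω lam α : ℝ) (hΩ : 0 < Ω) (hlam : 0 < lam) (hα : 0 < α) :
    -- no left inverse on the range is continuous at any point
    (∀ T : Set.range (FoldedSampling.foldedSampling Ω hlam hα) → FoldedSampling.PW Ω,
      Function.LeftInverse T (Set.rangeFactorization (FoldedSampling.foldedSampling Ω hlam hα)) →
      ∀ a, ¬ ContinuousAt T a) ∧
    (∀ f : FoldedSampling.PW Ω, ∃ ε : ℝ, 0 < ε ∧ ∀ δ : ℝ, 0 < δ → ∃ g : FoldedSampling.PW Ω,
      dist (FoldedSampling.foldedSampling Ω hlam hα f)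
        (FoldedSampling.foldedSampling Ω hlam hα g) < δ ∧ ε < ‖f - g‖) ∧
    -- the same for the restriction to real-valued functions
    (∀ T : Set.range (FoldedSampling.foldedSamplingReal Ω hlam hα) → FoldedSampling.PWReal Ω,
      Function.LeftInverse T
        (Set.rangeFactorization (FoldedSampling.foldedSamplingReal Ω hlam hα)) →
      ∀ a, ¬ ContinuousAt T a) ∧
    (∀ f : FoldedSampling.PWReal Ω, ∃ ε : ℝ, 0 < ε ∧ ∀ δ : ℝ, 0 < δ →
      ∃ g : FoldedSampling.PWReal Ω,
        dist (FoldedSampling.foldedSamplingReal Ω hlam hα f)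
          (FoldedSampling.foldedSamplingReal Ω hlam hα g) < δ ∧ ε < ‖f.1 - g.1‖) := by
  have h := fun f => FoldedSampling.exists_unstable hΩ hlam hα f
  have hr := fun f => FoldedSampling.exists_unstable_real hΩ hlam hα f
  exact ⟨fun T hT => FoldedSampling.not_continuousAt_of_leftInverse
      (by simpa only [Subtype.dist_eq, dist_eq_norm] using h) hT, h,
    fun T hT => FoldedSampling.not_continuousAt_of_leftInverse
      (by simpa only [Subtype.dist_eq, dist_eq_norm] using hr) hT, hr⟩
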